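/- Let $k$ be a field and let $\Pi$ be a finite poset. A sheaf on $\Pi$ is a functor $F$ from $\Pi$ to finite-dimensional $k$-vector spaces: vector spaces $F(\pi)$ and compatible linear maps $F(\pi\le\tau)$. Sheaves with natural transformations form an abelian category, with kernels and cokernels taken pointwise. All complexes are bounded and indexed by $\mathbb Z$. A complex of injective sheaves is a bounded complex all of whose terms are injective objects of this category. For $\pi\in\Pi$ let $[\pi]$ be the sheaf with $[\pi](\sigma)=k$ if $\sigma\le\pi$ and $0$ otherwise, the map for $\sigma\le\tau$ being the identity if $\tau\le\pi$ and $0$ otherwise. Every injective sheaf is a finite direct sum of sheaves $[\pi]$; the number of its indecomposable summands is the number of terms of such a sum. A complex of injective sheaves $I^\bullet$ is minimal if, for every complex of injective sheaves $K^\bullet$ such that there is a quasi-isomorphism $I^\bullet\to K^\bullet$, and for every $d$, the number of indecomposable summands of $I^d$ is at most that of $K^d$. A minimal injective resolution of a complex $F^\bullet$ is a quasi-isomorphism $F^\bullet\to I^\bullet$ to a minimal complex of injective sheaves. **Corollary.** Let $J^\bullet$ be a complex of injective sheaves on $\Pi$. Then $J^\bullet$ has a minimal injective resolution, and for every minimal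 injective resolution $J^\bullet\to I^\bullet$ the following hold. 1. There are an exact complex of injective sheaves $E^\bullet$ and an isomorphism of complexes $J^\bullet\cong I^\bullet\oplus E^\bullet$. 2. There is a quasi-isomorphism $q^\bullet: I^\bullet\to J^\bullet$. Every such quasi-isomorphism is injective in each degree and at each point of $\Pi$, and it fits into a short exact sequence of complexes $$0\to I^\bullet\xrightarrow{q^\bullet}J^\bullet\xrightarrow{p^\bullet}E^\bullet\to 0,$$ with $E^\bullet$ an exact complex of injective sheaves, which splits in the category of complexes of sheaves: there is an isomorphism of complexes $J^\bullet\cong I^\bullet\oplus E^\bullet$ that identifies $q^\bullet$ with the inclusion of $I^\bullet$ and $p^\bullet$ with the projection onto $E^\bullet$. -/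

import Mathlib

open CategoryTheory CategoryTheory.Limits

universe u w

namespace PosetSheaf

/-- The category of sheaves of finite-dimensional `k`-vector spaces on a poset `P`: a sheaf assigns
a finite-dimensional vector space to each element and a linear map to each relation `σ ≤ τ`,
functorially; morphisms are natural transformations. -/
abbrev Sh (k : Type u) [Field k] (P : Type w) [PartialOrder P] : Type (max (u + 1) w) :=
  P ⥤ FGModuleCat.{u} k

section

variable (k : Type u) [Field k] {P : Type w} [PartialOrder P]

/-- The indecomposable injective sheaf `[π]`. Its value at `σ` is the space of functions to `k` from
the type of proofs of `σ ≤ π`: this is a copy of `k` if `σ ≤ π`, and it is `0` otherwise. The map for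
`σ ≤ τ` sends `x` to the function with the same value; it is the identity of `k` if
`σ ≤ τ ≤ π`, and it is `0` otherwise. -/
noncomputable def indec (π : P) : Sh k P where
  obj σ := FGModuleCat.of k (PLift (σ ≤ π) → k)
  map h := FGModuleCat.ofHom
    { toFun := fun x p => x ⟨(leOfHom h).trans p.down⟩
      map_add' := fun _ _ => rfl
      map_smul' := fun _ _ => rfl }
  map_id _ := rfl
  map_comp _ _ := rfl

instance : HasFiniteBiproducts (Sh k P) := Abelian.hasFiniteBiproducts

variable {k}

/-- The sheaf `F` is a direct sum of `n` sheaves of the form `[π]` (repetitions allowed). -/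
def HasSummandCount (F : Sh k P) (n : ℕ) : Prop :=
  ∃ π : Fin n → P, Nonempty (F ≅ ⨁ fun i => indec k (π i))

/-- A bounded complex: all but finitely many of its sheaves vanish. -/
def IsBounded (A : CochainComplex (Sh k P) ℤ) : Prop :=
  ∃ N : ℤ, ∀ d : ℤ, N < |d| → IsZero (A.X d)

/-- A (bounded) complex of injective sheaves. -/
structure IsInjectiveComplex (A : CochainComplex (Sh k P) ℤ) : Prop where
  bounded : IsBounded A
  injective : ∀ d : ℤ, Injective (A.X d)

/-- A complex of injective sheaves is minimal if, in each degree, it has at most as many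
indecomposable summands as any complex of injective sheaves quasi-isomorphic to it. -/
structure IsMinimal (I : CochainComplex (Sh k P) ℤ) : Prop where
  isInjectiveComplex : IsInjectiveComplex I
  le : ∀ J : CochainComplex (Sh k P) ℤ, IsInjectiveComplex J →
    (∃ f : I ⟶ J, QuasiIso f) →
    ∀ (d : ℤ) (m n : ℕ), HasSummandCount (I.X d) m → HasSummandCount (J.X d) n → m ≤ n

/-- `α : F ⟶ I` is a minimal injective resolution of the complex `F`: a quasi-isomorphism to a
minimal complex of injective sheaves. -/
structure IsMinimalInjectiveResolution {F I : CochainComplex (Sh k P) ℤ} (α : F ⟶ I) : Prop where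
  quasiIso : QuasiIso α
  minimal : IsMinimal I

end

end PosetSheaf

/-! The number of summands `[π]` of an injective sheaf is the total dimension of its socle
(`HasSummandCount.socleRank_eq`, `hasSummandCount_socleRank`). This number does not grow on passing
to a retract, and a retract with the same number is everything (`isIso_of_retract_of_socleRank_le`).

The core is that a quasi-isomorphism `h : I ⟶ I` of a minimal complex is an isomorphism
(`IsSummandMinimal.isIso`). By Fitting's lemma the image of some power of `h` is a direct summand of
`I`; it is quasi-isomorphic to `I`, so minimality makes it all of `I`. Bounded complexes of
injectives are K-injective, so a quasi-isomorphism `q : I ⟶ J` has a quasi-inverse `g`. Then `q ≫ g`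
is an isomorphism, `q` splits, and its complement is acyclic.

For existence, pass to quasi-isomorphic summands until the socle rank stops dropping. -/

namespace PosetSheaf

/-! ### Socles of sheaves and the count of indecomposable injective summands -/

section Sections

variable {k : Type u} [Field k] {P : Type w} [PartialOrder P]

/-- The linear map on sections over `π` of a morphism of sheaves. -/
def sectionMap {F G : Sh k P} (f : F ⟶ G) (π : P) : (F.obj π).obj →ₗ[k] (G.obj π).obj :=
  (f.app π).hom.hom

/-- The restriction map `F(π) → F(τ)` of a sheaf for `π ≤ τ`. -/
def restrict (F : Sh k P) {π τ : P} (h : π ≤ τ) : (F.obj π).obj →ₗ[k] (F.obj τ).obj :=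
  (F.map (homOfLE h)).hom.hom

@[simp]
lemma sectionMap_comp {F G H : Sh k P} (f : F ⟶ G) (g : G ⟶ H) (π : P)
    (x : (F.obj π).obj) :
    sectionMap (f ≫ g) π x = sectionMap g π (sectionMap f π x) := rfl

@[simp]
lemma sectionMap_id (F : Sh k P) (π : P) (x : (F.obj π).obj) :
    sectionMap (𝟙 F) π x = x := rfl

@[simp]
lemma sectionMap_zero (F G : Sh k P) (π : P) (x : (F.obj π).obj) :
    sectionMap (0 : F ⟶ G) π x = 0 := rfl

@[simp]
lemma sectionMap_sum {ι : Type*} (s : Finset ι) {F G : Sh k P} (f : ι → (F ⟶ G)) (π : P)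
    (x : (F.obj π).obj) :
    sectionMap (∑ i ∈ s, f i) π x = ∑ i ∈ s, sectionMap (f i) π x := by
  classical
  induction s using Finset.induction_on with
  | empty => simp
  | insert a s ha ih => rw [Finset.sum_insert ha, Finset.sum_insert ha, ← ih]; rfl

lemma hom_ext_sectionMap {F G : Sh k P} {f g : F ⟶ G}
    (h : ∀ π x, sectionMap f π x = sectionMap g π x) : f = g := by
  ext π : 2
  exact FGModuleCat.hom_ext (LinearMap.ext (h π))

lemma sectionMap_restrict {F G : Sh k P} (f : F ⟶ G) {π τ : P} (h : π ≤ τ)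
    (x : (F.obj π).obj) :
    sectionMap f τ (restrict F h x) = restrict G h (sectionMap f π x) := by
  have := f.naturality (homOfLE h)
  exact congr($(this).hom.hom x)

lemma restrict_restrict (F : Sh k P) {π τ ρ : P} (h : π ≤ τ) (h' : τ ≤ ρ)
    (x : (F.obj π).obj) :
    restrict F h' (restrict F h x) = restrict F (h.trans h') x := by
  have := F.map_comp (homOfLE h) (homOfLE h')
  exact congr($(this).hom.hom x).symm

lemma restrict_refl (F : Sh k P) (π : P) (x : (F.obj π).obj) :
    restrict F le_rfl x = x :=
  congr($(F.map_id π).hom.hom x)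

lemma subsingleton_of_isZero {F : Sh k P} (hF : IsZero F) (π : P) :
    Subsingleton (F.obj π).obj := by
  refine subsingleton_of_forall_eq 0 fun x => ?_
  rw [← sectionMap_id F π x, hF.eq_of_src (𝟙 F) 0, sectionMap_zero]

lemma mono_of_sectionMap {F G : Sh k P} (f : F ⟶ G)
    (h : ∀ π x, sectionMap f π x = 0 → x = 0) : Mono f := by
  refine Preadditive.mono_of_cancel_zero f fun g hg => hom_ext_sectionMap fun π x => ?_
  apply h
  rw [← sectionMap_comp, hg, sectionMap_zero]

/-- The sections over `π` which restrict to zero over every `τ > π`. -/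
def socle (F : Sh k P) (π : P) : Submodule k (F.obj π).obj :=
  ⨅ (τ : P) (h : π < τ), LinearMap.ker (restrict F h.le)

lemma mem_socle {F : Sh k P} {π : P} {x : (F.obj π).obj} :
    x ∈ socle F π ↔ ∀ (τ : P) (h : π < τ), restrict F h.le x = 0 := by
  simp [socle]

/-- The map induced on socles by a morphism of sheaves. -/
def socleMap {F G : Sh k P} (f : F ⟶ G) (π : P) : socle F π →ₗ[k] socle G π :=
  (sectionMap f π).restrict fun x hx => mem_socle.2 fun τ h => by
    rw [← sectionMap_restrict, mem_socle.1 hx τ h, map_zero]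

@[simp]
lemma coe_socleMap {F G : Sh k P} (f : F ⟶ G) (π : P) (x : socle F π) :
    (socleMap f π x : (G.obj π).obj) = sectionMap f π x := rfl

/-- A morphism which is injective on socles is a monomorphism. -/
lemma mono_of_socle [Finite P] {F G : Sh k P} (f : F ⟶ G)
    (h : ∀ π, ∀ x ∈ socle F π, sectionMap f π x = 0 → x = 0) : Mono f := by
  refine mono_of_sectionMap f fun π => ?_
  induction π using WellFoundedGT.induction with
  | ind π ih =>
    intro x hx
    -- Downward induction: the restrictions of `x` to each `τ > π` lie in the kernel, hence vanish,
    -- so `x` is in the socle.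
    refine h π x (mem_socle.2 fun τ hτ => ih τ hτ _ ?_) hx
    rw [sectionMap_restrict, hx, map_zero]

lemma socleMap_injective_of_retract {F G : Sh k P} {i : F ⟶ G} {r : G ⟶ F}
    (h : i ≫ r = 𝟙 F) (π : P) : Function.Injective (socleMap i π) := by
  refine Function.LeftInverse.injective (g := socleMap r π) fun x => Subtype.ext ?_
  rw [coe_socleMap, coe_socleMap, ← sectionMap_comp, h, sectionMap_id]

lemma indec_ext {π σ : P} {x y : ((indec k π).obj σ).obj}
    (h : ∀ p, (x : PLift (σ ≤ π) → k) p = (y : PLift (σ ≤ π) → k) p) : x = y :=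
  funext h

/-- Over `π` every section dies at all larger elements, while for `σ < π` restriction to `π` is
injective. Socles thus detect which `[π]` occur. -/
lemma finrank_socle_indec [DecidableEq P] (π σ : P) :
    Module.finrank k (socle (indec k π) σ) = if σ = π then 1 else 0 := by
  split_ifs with h
  · subst h
    have htop : socle (indec k σ) σ = ⊤ := eq_top_iff.2 fun x _ => mem_socle.2 fun τ hτ =>
      indec_ext fun p => (hτ.not_ge p.down).elim
    rw [htop, finrank_top]
    have : Unique (PLift (σ ≤ σ)) := ⟨⟨⟨le_rfl⟩⟩, fun _ => rfl⟩
    exact (Module.finrank_fintype_fun_eq_card (η := PLift (σ ≤ σ)) k).trans (Fintype.card_unique)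
  · have hbot : socle (indec k π) σ = ⊥ := by
      refine eq_bot_iff.2 fun x hx => indec_ext fun p => ?_
      exact congrFun (mem_socle.1 hx π (lt_of_le_of_ne p.down h)) ⟨le_rfl⟩
    rw [hbot, finrank_bot]

/-- The socle of a finite direct sum is the product of the socles. -/
noncomputable def socleBiproductEquiv {n : ℕ} (F : Fin n → Sh k P) (π : P) :
    socle (⨁ F) π ≃ₗ[k] ((i : Fin n) → socle (F i) π) where
  toFun x i := socleMap (biproduct.π F i) π x
  map_add' x y := by ext; simp
  map_smul' c x := by ext; simp
  invFun y := ∑ i, socleMap (biproduct.ι F i) π (y i)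
  left_inv x := by
    refine Subtype.ext ?_
    have := congr(sectionMap $(biproduct.total (f := F)) π x)
    rw [sectionMap_sum, sectionMap_id] at this
    simpa only [AddSubmonoidClass.coe_finsetSum, coe_socleMap, sectionMap_comp] using this
  right_inv y := by
    funext j
    refine Subtype.ext ?_
    have (i : Fin n) : sectionMap (biproduct.π F j) π (sectionMap (biproduct.ι F i) π (y i)) =
        if i = j then (y j : ((F j).obj π).obj) else 0 := by
      rw [← sectionMap_comp]
      split_ifs with h
      · subst h; rw [biproduct.ι_π_self, sectionMap_id]
      · rw [biproduct.ι_π_ne _ h, sectionMap_zero]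
    simp [this]

/-- The morphism `F ⟶ [π]` given by a linear form on `F(π)`. -/
def toIndec (F : Sh k P) (π : P) (φ : (F.obj π).obj →ₗ[k] k) : F ⟶ indec k π where
  app σ := FGModuleCat.ofHom
    { toFun := fun x (p : PLift (σ ≤ π)) => φ (restrict F p.down x)
      map_add' := fun x y => by ext; simp
      map_smul' := fun c x => by ext; simp }
  naturality σ τ h := by
    refine FGModuleCat.hom_ext (LinearMap.ext fun x => indec_ext fun p => ?_)
    exact congrArg φ (restrict_restrict F (leOfHom h) p.down x)

lemma sectionMap_toIndec (F : Sh k P) (π : P) (φ : (F.obj π).obj →ₗ[k] k) {σ : P}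
    (x : (F.obj σ).obj) (p : PLift (σ ≤ π)) :
    (sectionMap (toIndec F π φ) σ x : PLift (σ ≤ π) → k) p = φ (restrict F p.down x) := rfl

variable [Fintype P]

/-- The total dimension of the socle of a sheaf. -/
noncomputable def socleRank (F : Sh k P) : ℕ :=
  ∑ π : P, Module.finrank k (socle F π)

lemma socleRank_le_of_retract {F G : Sh k P} {i : F ⟶ G} {r : G ⟶ F} (h : i ≫ r = 𝟙 F) :
    socleRank F ≤ socleRank G :=
  Finset.sum_le_sum fun π _ =>
    LinearMap.finrank_le_finrank_of_injective (socleMap_injective_of_retract h π)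

lemma socleRank_congr {F G : Sh k P} (e : F ≅ G) : socleRank F = socleRank G :=
  (socleRank_le_of_retract e.hom_inv_id).antisymm (socleRank_le_of_retract e.inv_hom_id)

/-- The inclusion of a direct summand which has the whole socle is an isomorphism. -/
lemma isIso_of_retract_of_socleRank_le {F G : Sh k P} {i : F ⟶ G} {r : G ⟶ F}
    (h : i ≫ r = 𝟙 F) (hle : socleRank G ≤ socleRank F) : IsIso r := by
  have hrank := (Finset.sum_eq_sum_iff_of_le (s := Finset.univ) fun π _ =>
    LinearMap.finrank_le_finrank_of_injective (socleMap_injective_of_retract h π)).1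
      ((socleRank_le_of_retract h).antisymm hle)
  have : Mono r := by
    refine mono_of_socle r fun π x hx hrx => ?_
    obtain ⟨y, hy⟩ := ((LinearMap.injective_iff_surjective_of_finrank_eq_finrank
      (hrank π (Finset.mem_univ π))).1 (socleMap_injective_of_retract h π)) ⟨x, hx⟩
    have hy : sectionMap i π y = x := congrArg Subtype.val hy
    rw [← hy, ← sectionMap_comp, h, sectionMap_id] at hrx
    rw [← hy, hrx, map_zero]
  have : IsSplitEpi r := ⟨⟨⟨i, h⟩⟩⟩
  exact isIso_of_mono_of_isSplitEpi r

lemma socleRank_indec (π : P) : socleRank (indec k π) = 1 := by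
  classical
  simp [socleRank, finrank_socle_indec]

lemma socleRank_biproduct {n : ℕ} (F : Fin n → Sh k P) :
    socleRank (⨁ F) = ∑ i, socleRank (F i) := by
  simp only [socleRank]
  rw [Finset.sum_comm]
  refine Finset.sum_congr rfl fun π _ => ?_
  rw [(socleBiproductEquiv F π).finrank_eq, Module.finrank_pi_fintype]

lemma HasSummandCount.socleRank_eq {F : Sh k P} {n : ℕ} (h : HasSummandCount F n) :
    socleRank F = n := by
  obtain ⟨π, ⟨e⟩⟩ := h
  rw [socleRank_congr e, socleRank_biproduct]
  simp [socleRank_indec]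

/-- An injective sheaf is a direct sum of as many sheaves `[π]` as the dimension of its socle. -/
lemma hasSummandCount_socleRank (F : Sh k P) [Injective F] :
    HasSummandCount F (socleRank F) := by
  have e : (Σ π : P, Fin (Module.finrank k (socle F π))) ≃ Fin (socleRank F) :=
    Fintype.equivFinOfCardEq (by simp [socleRank])
  have hφ (s : Σ π : P, Fin (Module.finrank k (socle F π))) :
      ∃ φ : (F.obj s.1).obj →ₗ[k] k, ∀ x : socle F s.1,
        φ x = (Module.finBasis k (socle F s.1)).coord s.2 x := by
    obtain ⟨φ, hφ⟩ := LinearMap.exists_extend ((Module.finBasis k (socle F s.1)).coord s.2)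
    exact ⟨φ, fun x => congr($hφ x)⟩
  choose φ hφ using hφ
  -- One summand per vector of a basis of each socle, mapped to by a linear extension of the
  -- corresponding coordinate; so `f` is injective on socles.
  let f : F ⟶ ⨁ fun i => indec k (e.symm i).1 :=
    biproduct.lift fun i => toIndec F (e.symm i).1 (φ (e.symm i))
  have : Mono f := by
    refine mono_of_socle f fun π x hx h => ?_
    suffices (⟨x, hx⟩ : socle F π) = 0 from congrArg Subtype.val this
    refine (Module.finBasis k (socle F π)).ext_elem fun j => ?_
    have key (s : Σ π : P, Fin (Module.finrank k (socle F π))) :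
        sectionMap (toIndec F s.1 (φ s)) π x = 0 := by
      obtain ⟨i, rfl⟩ := e.symm.surjective s
      have : f ≫ biproduct.π _ i = toIndec F (e.symm i).1 (φ (e.symm i)) :=
        biproduct.lift_π _ _
      rw [← this, sectionMap_comp, h, map_zero]
    have h0 := congrFun (key ⟨π, j⟩) ⟨le_rfl⟩
    rw [sectionMap_toIndec, restrict_refl] at h0
    have h1 := hφ ⟨π, j⟩ ⟨x, hx⟩
    rw [map_zero, Finsupp.zero_apply]
    exact h1.symm.trans h0
  have hr : f ≫ Injective.factorThru (𝟙 F) f = 𝟙 F := Injective.comp_factorThru _ _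
  have := isIso_of_retract_of_socleRank_le hr (by
    rw [socleRank_biproduct]; simp [socleRank_indec])
  exact ⟨_, ⟨(asIso (Injective.factorThru (𝟙 F) f)).symm⟩⟩

end Sections

/-! ### Fitting's lemma and split quasi-isomorphisms in abelian categories -/

section Categorical

variable {C : Type*} [Category* C] [Abelian C]

/-- Fitting's lemma: an endomorphism `e` such that `e ≫ e` has the same kernel and the same
cokernel as `e` factors through a direct summand. -/
lemma exists_retract_of_fitting {X : C} (e : X ⟶ X)
    (hker : ∀ {T : C} (x : T ⟶ X), x ≫ e ≫ e = 0 → x ≫ e = 0)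
    (hcoker : ∀ {T : C} (y : X ⟶ T), e ≫ e ≫ y = 0 → e ≫ y = 0) :
    ∃ (B : C) (p : X ⟶ B) (i : B ⟶ X), p ≫ i = e ∧ IsIso (i ≫ p) := by
  suffices ∀ (B : C) (p : X ⟶ B) (i : B ⟶ X), Epi p → Mono i → p ≫ i = e → IsIso (i ≫ p) from
    ⟨_, Abelian.factorThruImage e, Abelian.image.ι e, Abelian.image.fac e,
      this _ _ _ inferInstance inferInstance (Abelian.image.fac e)⟩
  rintro B p i hp hi rfl
  have : Mono (i ≫ p) := by
    refine Preadditive.mono_of_cancel_zero _ fun x hx => ?_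
    obtain ⟨T, π, _, y, hy⟩ := surjective_up_to_refinements_of_epi p x
    have h0 : y ≫ p ≫ i = 0 := hker y (by
      simp only [Category.assoc] at hx ⊢
      rw [← reassoc_of% hy, reassoc_of% hx, zero_comp, comp_zero])
    rw [← reassoc_of% hy] at h0
    exact zero_of_epi_comp π (zero_of_comp_mono i (by simpa using h0))
  have : Epi (i ≫ p) := by
    refine Preadditive.epi_of_cancel_zero _ fun y hy => ?_
    -- Dual to the lift through `p` above: `y` extends along the mono `i` after the mono
    -- `pushout.inr i y`.
    have hz : i ≫ pushout.inl i y = y ≫ pushout.inr i y := pushout.condition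
    have h0 : (p ≫ i) ≫ pushout.inl i y = 0 := hcoker _ (by
      simp only [Category.assoc] at hy ⊢
      rw [hz, reassoc_of% hy, zero_comp, comp_zero])
    rw [Category.assoc, hz] at h0
    exact zero_of_comp_mono (pushout.inr i y) (zero_of_epi_comp p h0)
  exact isIso_of_mono_of_epi _

lemma isIso_of_comp_isIso {X Y Z W : C} (f : X ⟶ Y) (g : Y ⟶ Z) (h : Z ⟶ W)
    [IsIso (f ≫ g)] [IsIso (g ≫ h)] : IsIso g := by
  have := mono_of_mono g h
  have := epi_of_epi f g
  exact isIso_of_mono_of_epi g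

/-- Two-out-of-six on homology: the first composite makes `g` epi there, the second mono. -/
lemma quasiIso_of_comp_quasiIso {X Y Z W : CochainComplex C ℤ} (f : X ⟶ Y) (g : Y ⟶ Z)
    (h : Z ⟶ W) [QuasiIso (f ≫ g)] [QuasiIso (g ≫ h)] : QuasiIso g := by
  refine ⟨fun d => ?_⟩
  rw [quasiIsoAt_iff_isIso_homologyMap]
  have : IsIso (HomologicalComplex.homologyMap f d ≫ HomologicalComplex.homologyMap g d) := by
    rw [← HomologicalComplex.homologyMap_comp]; infer_instance
  have : IsIso (HomologicalComplex.homologyMap g d ≫ HomologicalComplex.homologyMap h d) := by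
    rw [← HomologicalComplex.homologyMap_comp]; infer_instance
  exact isIso_of_comp_isIso (HomologicalComplex.homologyMap f d) _
    (HomologicalComplex.homologyMap h d)

lemma quasiIso_pow {X : CochainComplex C ℤ} (h : End X) (hh : QuasiIso (h : X ⟶ X)) (n : ℕ) :
    QuasiIso (h ^ n : End X) := by
  induction n with
  | zero => exact inferInstanceAs (QuasiIso (𝟙 X))
  | succ n ih => exact quasiIso_comp h (h ^ n : End X)

lemma Splitting.f_isoBinaryBiproduct_hom {S : ShortComplex C} (σ : S.Splitting) :
    S.f ≫ σ.isoBinaryBiproduct.hom = biprod.inl := by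
  apply biprod.hom_ext <;> simp

lemma Splitting.isoBinaryBiproduct_hom_snd {S : ShortComplex C} (σ : S.Splitting) :
    σ.isoBinaryBiproduct.hom ≫ biprod.snd = S.g := by
  simp

/-- A quasi-isomorphism with a retraction is the inclusion of a direct summand with acyclic
complement. -/
lemma exists_splitting_of_retraction {I J : CochainComplex C ℤ} (q : I ⟶ J) [QuasiIso q]
    (r : J ⟶ I) (hr : q ≫ r = 𝟙 I) :
    ∃ (E : CochainComplex C ℤ) (p : J ⟶ E) (s : E ⟶ J) (h : q ≫ p = 0), s ≫ p = 𝟙 E ∧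
      E.Acyclic ∧ (ShortComplex.mk q p h).ShortExact ∧
      Nonempty (ShortComplex.mk q p h).Splitting ∧
      ∃ e : J ≅ I ⊞ E, q ≫ e.hom = biprod.inl ∧ e.hom ≫ biprod.snd = p := by
  have : Mono q := mono_of_mono_fac hr
  let S := ShortComplex.mk q (cokernel.π q) (cokernel.condition q)
  have hS : S.Exact := ShortComplex.exact_cokernel q
  let σ : S.Splitting := ShortComplex.Splitting.ofExactOfRetraction S hS r hr inferInstance
  refine ⟨cokernel q, cokernel.π q, σ.s, cokernel.condition q, σ.s_g, fun d => ?_,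
    σ.shortExact, ⟨σ⟩, σ.isoBinaryBiproduct, ?_, ?_⟩
  · rw [HomologicalComplex.exactAt_iff_isZero_homology, IsZero.iff_id_eq_zero]
    -- `q` is an isomorphism on homology, so the projection is zero there; being split epi, it
    -- forces the homology of the cokernel to vanish.
    have h0 : HomologicalComplex.homologyMap (cokernel.π q) d = 0 := by
      rw [← cancel_epi (HomologicalComplex.homologyMap q d),
        ← HomologicalComplex.homologyMap_comp, cokernel.condition,
        HomologicalComplex.homologyMap_zero, comp_zero]
    have h1 : σ.s ≫ cokernel.π q = 𝟙 _ := σ.s_g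
    rw [← HomologicalComplex.homologyMap_id]
    rw [← h1, HomologicalComplex.homologyMap_comp, h0, comp_zero]
  · exact Splitting.f_isoBinaryBiproduct_hom σ
  · exact Splitting.isoBinaryBiproduct_hom_snd σ

lemma isZero_of_retract {X Y : C}
    (h : Retract X Y) (hY : IsZero Y) : IsZero X := by
  rw [IsZero.iff_id_eq_zero, ← h.retract, hY.eq_of_tgt h.i 0, zero_comp]

end Categorical

/-! ### Bounded complexes of sheaves: K-injectivity and Fitting decomposition -/

section Complexes

variable {k : Type u} [Field k] {P : Type w} [PartialOrder P]

lemma IsInjectiveComplex.of_retract {B I : CochainComplex (Sh k P) ℤ}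
    (hI : IsInjectiveComplex I) (i : B ⟶ I) (r : I ⟶ B) (h : i ≫ r = 𝟙 B) :
    IsInjectiveComplex B := by
  have ret (d : ℤ) : Retract (B.X d) (I.X d) :=
    ⟨i.f d, r.f d, by rw [← HomologicalComplex.comp_f, h, HomologicalComplex.id_f]⟩
  obtain ⟨N, hN⟩ := hI.bounded
  refine ⟨⟨N, fun d hd => isZero_of_retract (ret d) (hN d hd)⟩, fun d => ?_⟩
  have := hI.injective d
  exact (ret d).injective

lemma IsInjectiveComplex.isKInjective {I : CochainComplex (Sh k P) ℤ}
    (hI : IsInjectiveComplex I) : I.IsKInjective := by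
  obtain ⟨N, hN⟩ := hI.bounded
  have := hI.injective
  have : I.IsStrictlyGE (-N) := by
    rw [CochainComplex.isStrictlyGE_iff]
    exact fun i hi => hN i (lt_abs.2 (Or.inr (by lia)))
  exact CochainComplex.isKInjective_of_injective I (-N)

/-- A quasi-isomorphism of complexes of injective sheaves has a quasi-inverse. -/
lemma IsInjectiveComplex.exists_quasiIso_inverse {I K : CochainComplex (Sh k P) ℤ}
    (hI : IsInjectiveComplex I) (hK : IsInjectiveComplex K) (q : I ⟶ K) [QuasiIso q] :
    ∃ g : K ⟶ I, QuasiIso g := by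
  have := hI.isKInjective
  have := hK.isKInjective
  obtain ⟨e, -⟩ := (CochainComplex.IsKInjective.quasiIso_iff q).1 inferInstance
  exact ⟨e.inv, inferInstanceAs (QuasiIso e.symm.hom)⟩

lemma sectionMap_pow {I : CochainComplex (Sh k P) ℤ} (h : End I) (n : ℕ) (d : ℤ) (π : P) :
    sectionMap (((h ^ n : End I) : I ⟶ I).f d) π = (sectionMap ((h : I ⟶ I).f d) π) ^ n := by
  induction n with
  | zero => rfl
  | succ n ih => rw [pow_succ, pow_succ, ← ih]; rfl

variable [Finite P]

/-- Each stalk is finite-dimensional and only finitely many pairs `(d, π)` matter, so one exponent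
serves for all. -/
lemma exists_pow_isCompl {I : CochainComplex (Sh k P) ℤ} (hI : IsBounded I) (h : End I) :
    ∃ n ≠ 0, ∀ (d : ℤ) (π : P),
      IsCompl (LinearMap.ker (sectionMap (((h ^ n : End I) : I ⟶ I).f d) π))
        (LinearMap.range (sectionMap (((h ^ n : End I) : I ⟶ I).f d) π)) := by
  obtain ⟨N, hN⟩ := hI
  have (d : ℤ) (π : P) : Module.Finite k ((I.X d).obj π).obj := ((I.X d).obj π).property
  have key : ∀ᶠ n in Filter.atTop, ∀ d ∈ Finset.Icc (-N) N, ∀ π : P,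
      IsCompl (LinearMap.ker ((sectionMap ((h : I ⟶ I).f d) π) ^ n))
        (LinearMap.range ((sectionMap ((h : I ⟶ I).f d) π) ^ n)) := by
    rw [Filter.eventually_all_finset]
    intro d _
    rw [Filter.eventually_all]
    exact fun π => LinearMap.eventually_isCompl_ker_pow_range_pow _
  obtain ⟨n, hn, hn0⟩ := (key.and (Filter.eventually_ne_atTop 0)).exists
  refine ⟨n, hn0, fun d π => ?_⟩
  rw [sectionMap_pow]
  by_cases hd : d ∈ Finset.Icc (-N) N
  · exact hn d hd π
  · have hz : IsZero (I.X d) := by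
      refine hN d ?_
      rw [Finset.mem_Icc] at hd
      rw [lt_abs]
      lia
    have := subsingleton_of_isZero hz π
    exact ⟨disjoint_of_subsingleton, codisjoint_of_subsingleton⟩

/-- A quasi-isomorphism from a bounded complex to itself which is not an isomorphism factors through
a proper direct summand. -/
lemma exists_retract_of_quasiIso {I : CochainComplex (Sh k P) ℤ} (hI : IsBounded I) (h : I ⟶ I)
    [QuasiIso h] :
    ∃ (B : CochainComplex (Sh k P) ℤ) (i : B ⟶ I) (r : I ⟶ B), i ≫ r = 𝟙 B ∧ QuasiIso r ∧
      (IsIso r → IsIso h) := by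
  obtain ⟨n, hn0, hn⟩ := exists_pow_isCompl hI h
  set e : I ⟶ I := ((show End I from h) ^ n : End I) with he
  have : QuasiIso e := quasiIso_pow h inferInstance n
  obtain ⟨B, p, i, hpi, hip⟩ := exists_retract_of_fitting e
    (fun {T} x hx => by
      ext d : 1
      refine hom_ext_sectionMap fun π t => ?_
      have h0 : sectionMap ((x ≫ e ≫ e).f d) π t = 0 := by rw [hx]; rfl
      exact (Submodule.disjoint_def.1 (hn d π).disjoint) _ h0 ⟨_, rfl⟩)
    (fun {T} y hy => by
      ext d : 1
      refine hom_ext_sectionMap fun π t => ?_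
      have ht : t ∈ LinearMap.ker (sectionMap (e.f d) π) ⊔ LinearMap.range (sectionMap (e.f d) π) :=
        (hn d π).sup_eq_top ▸ Submodule.mem_top
      obtain ⟨a, ha, _, ⟨b, rfl⟩, rfl⟩ := Submodule.mem_sup.1 ht
      have h0 : sectionMap ((e ≫ e ≫ y).f d) π b = 0 := by rw [hy]; rfl
      have ha : sectionMap (e.f d) π a = 0 := ha
      rw [map_add, HomologicalComplex.comp_f, sectionMap_comp, ha, map_zero, zero_add]
      exact h0)
  have : QuasiIso (p ≫ i) := by rw [hpi]; infer_instance
  -- Two-out-of-six applies since `p ≫ i = e` is a quasi-isomorphism and `i ≫ p` an isomorphism.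
  have : QuasiIso i := quasiIso_of_comp_quasiIso p i p
  have : QuasiIso p := quasiIso_of_comp_left i p
  refine ⟨B, i, p ≫ inv (i ≫ p), by rw [← Category.assoc, IsIso.hom_inv_id], inferInstance,
    fun hr => ?_⟩
  have : IsIso p := IsIso.of_isIso_comp_right p (inv (i ≫ p))
  have : IsIso i := IsIso.of_isIso_comp_right i p
  have he' : IsIso e := by rw [← hpi]; infer_instance
  rw [he, ← isUnit_iff_isIso, isUnit_pow_iff hn0] at he'
  exact (isUnit_iff_isIso (show End I from h)).1 he'

end Complexes

/-! ### Minimality tested on direct summands -/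

section Minimal

variable {k : Type u} [Field k] {P : Type w} [PartialOrder P] [Fintype P]

/-- Every quasi-isomorphic direct summand has the same socle rank in each degree. -/
def IsSummandMinimal (I : CochainComplex (Sh k P) ℤ) : Prop :=
  ∀ (B : CochainComplex (Sh k P) ℤ) (i : B ⟶ I) (r : I ⟶ B), i ≫ r = 𝟙 B → QuasiIso r →
    ∀ d : ℤ, socleRank (I.X d) ≤ socleRank (B.X d)

lemma IsMinimal.isSummandMinimal {I : CochainComplex (Sh k P) ℤ} (hI : IsMinimal I) :
    IsSummandMinimal I := fun B i r h hr d => by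
  have hB := hI.isInjectiveComplex.of_retract i r h
  have := hI.isInjectiveComplex.injective d
  have := hB.injective d
  exact hI.le B hB ⟨r, hr⟩ d _ _ (hasSummandCount_socleRank _) (hasSummandCount_socleRank _)

lemma IsSummandMinimal.isIso {I : CochainComplex (Sh k P) ℤ} (hI : IsSummandMinimal I)
    (hb : IsBounded I) (h : I ⟶ I) [QuasiIso h] : IsIso h := by
  obtain ⟨B, i, r, hir, hr, hiso⟩ := exists_retract_of_quasiIso hb h
  refine hiso ?_
  have (d : ℤ) : IsIso (r.f d) := isIso_of_retract_of_socleRank_le (i := i.f d)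
    (by rw [← HomologicalComplex.comp_f, hir, HomologicalComplex.id_f]) (hI B i r hir hr d)
  exact HomologicalComplex.Hom.isIso_of_components r

/-- A quasi-isomorphism from a summand-minimal complex to a complex of injective sheaves splits. -/
lemma IsSummandMinimal.exists_retraction {I K : CochainComplex (Sh k P) ℤ}
    (hI : IsSummandMinimal I) (hI' : IsInjectiveComplex I) (hK : IsInjectiveComplex K)
    (q : I ⟶ K) [QuasiIso q] : ∃ r : K ⟶ I, q ≫ r = 𝟙 I := by
  obtain ⟨g, hg⟩ := hI'.exists_quasiIso_inverse hK q
  have := hI.isIso hI'.bounded (q ≫ g)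
  exact ⟨g ≫ inv (q ≫ g), by rw [← Category.assoc, IsIso.hom_inv_id]⟩

/-- Comparison with summands suffices, because `I` is a retract of every injective complex that it
maps to by a quasi-isomorphism. -/
lemma IsSummandMinimal.isMinimal {I : CochainComplex (Sh k P) ℤ}
    (hI : IsSummandMinimal I) (hI' : IsInjectiveComplex I) : IsMinimal I := by
  refine ⟨hI', fun K hK ⟨f, hf⟩ d m n hm hn => ?_⟩
  obtain ⟨r, hr⟩ := hI.exists_retraction hI' hK f
  rw [← hm.socleRank_eq, ← hn.socleRank_eq]
  exact socleRank_le_of_retract (i := f.f d) (r := r.f d)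
    (by rw [← HomologicalComplex.comp_f, hr, HomologicalComplex.id_f])

lemma socleRank_eq_zero {F : Sh k P} (hF : IsZero F) : socleRank F = 0 := by
  refine Finset.sum_eq_zero fun π _ => ?_
  have := subsingleton_of_isZero hF π
  exact Module.finrank_zero_of_subsingleton

/-- The sum of the socle ranks of the terms of a complex. -/
noncomputable def totalSocleRank (I : CochainComplex (Sh k P) ℤ) : ℕ :=
  ∑ᶠ d : ℤ, socleRank (I.X d)

lemma IsBounded.finite_support {I : CochainComplex (Sh k P) ℤ} (hI : IsBounded I) :
    (Function.support fun d : ℤ => socleRank (I.X d)).Finite := by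
  obtain ⟨N, hN⟩ := hI
  refine (Set.finite_Icc (-N) N).subset fun d hd => ?_
  by_contra h
  refine hd (socleRank_eq_zero (hN d ?_))
  rw [Set.mem_Icc] at h
  rw [lt_abs]
  lia

/-- Every complex of injective sheaves is quasi-isomorphic to a summand-minimal one. -/
lemma exists_isSummandMinimal {J : CochainComplex (Sh k P) ℤ} (hJ : IsInjectiveComplex J) :
    ∃ (I : CochainComplex (Sh k P) ℤ) (α : J ⟶ I), QuasiIso α ∧ IsInjectiveComplex I ∧
      IsSummandMinimal I := by
  induction hn : totalSocleRank J using Nat.strong_induction_on generalizing J with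
  | _ n ih =>
    by_cases hmin : IsSummandMinimal J
    · exact ⟨J, 𝟙 J, inferInstance, hJ, hmin⟩
    simp only [IsSummandMinimal, not_forall, not_le] at hmin
    obtain ⟨B, i, r, hir, hr, d, hd⟩ := hmin
    have hB := hJ.of_retract i r hir
    have hle (d : ℤ) : socleRank (B.X d) ≤ socleRank (J.X d) :=
      socleRank_le_of_retract (i := i.f d) (r := r.f d)
        (by rw [← HomologicalComplex.comp_f, hir, HomologicalComplex.id_f])
    have hlt : totalSocleRank B < n := by
      rw [← hn]
      have hfin := hJ.bounded.finite_support
      have hsub : (Function.support fun d : ℤ => socleRank (B.X d)) ⊆ hfin.toFinset := by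
        intro d hd
        have := hle d
        simp only [Function.mem_support, Set.Finite.coe_toFinset] at hd ⊢
        lia
      rw [totalSocleRank, totalSocleRank, finsum_eq_sum_of_support_subset _ hsub,
        finsum_eq_sum _ hfin]
      exact Finset.sum_lt_sum (fun d _ => hle d)
        ⟨d, hfin.mem_toFinset.2 (Nat.ne_zero_of_lt hd), hd⟩
    obtain ⟨I, α, hα, hI, hI'⟩ := ih _ hlt hB rfl
    exact ⟨I, r ≫ α, inferInstance, hI, hI'⟩

end Minimal

end PosetSheaf

theorem mainTheorem10 {k : Type u} [Field k] {P : Type w} [PartialOrder P] [Finite P]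
    (J : CochainComplex (PosetSheaf.Sh k P) ℤ) (hJ : PosetSheaf.IsInjectiveComplex J) :
    -- a minimal injective resolution exists
    (∃ (I : CochainComplex (PosetSheaf.Sh k P) ℤ) (α : J ⟶ I),
      PosetSheaf.IsMinimalInjectiveResolution α) ∧
    ∀ (I : CochainComplex (PosetSheaf.Sh k P) ℤ) (α : J ⟶ I),
      PosetSheaf.IsMinimalInjectiveResolution α →
      -- the decomposition
      (∃ E : CochainComplex (PosetSheaf.Sh k P) ℤ,
        PosetSheaf.IsInjectiveComplex E ∧ E.Acyclic ∧ Nonempty (J ≅ I ⊞ E)) ∧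
      -- the split short exact sequence
      (∃ q : I ⟶ J, QuasiIso q) ∧
      ∀ q : I ⟶ J, QuasiIso q →
        (∀ (d : ℤ) (π : P), Function.Injective ((q.f d).app π)) ∧
        ∃ (E : CochainComplex (PosetSheaf.Sh k P) ℤ) (p : J ⟶ E) (h : q ≫ p = 0),
          PosetSheaf.IsInjectiveComplex E ∧ E.Acyclic ∧
          (ShortComplex.mk q p h).ShortExact ∧
          Nonempty (ShortComplex.mk q p h).Splitting ∧
          ∃ e : J ≅ I ⊞ E, q ≫ e.hom = biprod.inl ∧ e.hom ≫ biprod.snd = p := by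
  cases nonempty_fintype P
  refine ⟨?_, fun I α hα => ?_⟩
  · obtain ⟨I, α, hα, hI, hmin⟩ := PosetSheaf.exists_isSummandMinimal hJ
    exact ⟨I, α, hα, hmin.isMinimal hI⟩
  have hI := hα.minimal.isInjectiveComplex
  have hmain (q : I ⟶ J) (hq : QuasiIso q) :
      (∀ (d : ℤ) (π : P), Function.Injective ((q.f d).app π)) ∧
        ∃ (E : CochainComplex (PosetSheaf.Sh k P) ℤ) (p : J ⟶ E) (h : q ≫ p = 0),
          PosetSheaf.IsInjectiveComplex E ∧ E.Acyclic ∧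
          (ShortComplex.mk q p h).ShortExact ∧
          Nonempty (ShortComplex.mk q p h).Splitting ∧
          ∃ e : J ≅ I ⊞ E, q ≫ e.hom = biprod.inl ∧ e.hom ≫ biprod.snd = p := by
    obtain ⟨r, hr⟩ := hα.minimal.isSummandMinimal.exists_retraction hI hJ q
    refine ⟨fun d π => Function.LeftInverse.injective (g := (r.f d).app π) fun x => ?_, ?_⟩
    · exact congr(PosetSheaf.sectionMap (HomologicalComplex.Hom.f $hr d) π x)
    · obtain ⟨E, p, s, h, hs, hE, hrest⟩ := PosetSheaf.exists_splitting_of_retraction q r hr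
      exact ⟨E, p, h, hJ.of_retract s p hs, hE, hrest⟩
  have := hα.quasiIso
  -- The resolution points from `J` to `I`; its quasi-inverse supplies the `q` to be split.
  obtain ⟨q, hq⟩ := hJ.exists_quasiIso_inverse hI α
  refine ⟨?_, ⟨q, hq⟩, hmain⟩
  obtain ⟨-, E, p, h, hE, hE', -, -, e, -⟩ := hmain q hq
  exact ⟨E, hE, hE', ⟨e⟩⟩
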